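/- Let $T>0$, $A\in\mathbb{R}^{n\times n}$, $B\in\mathbb{R}^{n\times p}$, $C\in\mathbb{R}^{q\times n}$, $x_0\in\mathbb{R}^n$, and let $w:[0,\infty)\to\mathbb{R}^n$ have a Laplace transform $W=\mathcal{L}[w]$ and be continuous on $[0,T]$. Consider the system $\dot x(t)=Ax(t)+Bu(t)+w(t)$, $y(t)=Cx(t)$, $x(0)=x_0$, on $[0,T]$, and put $$G_1(s)=C(sI-A)^{-1}B,\quad G_2(s)=\begin{bmatrix}C(sI-A)^{-1} & C(sI-A)^{-1}\end{bmatrix},\quad D(s)=\begin{bmatrix}x_0\\ W(s)\end{bmatrix}.$$ Here a function on $[0,\infty)$ has a Laplace transform if its product with $e^{-\sigma t}$ is integrable on $[0,\infty)$ for some real $\sigma$; equations in $s$ are required on some right half-plane $\{\operatorname{Re}s>\sigma\}$; and a signal given on $[0,T]$ enters an equation through the Laplace transform of some extension of it to $[0,\infty)$ that has a Laplace transform. An input $u:[0,T]\to\mathbb{R}^p$ generates $y_d:[0,T]\to\mathbb{R}^q$ if, for suitable such extensions with transforms $U$ and $Y_d$, $$G_1(s)U(s)=Y_d(s)-G_2(s)D(s),$$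 and $y_d$ is trackable if some input generates it. Then for every $y_d\in C^1([0,T],\mathbb{R}^q)$ the following hold. 1. Let $q\ge p$ and let $CB$ have full column rank. Then $y_d$ is trackable if and only if $y_d(0)=Cx_0$ and, for the transform $Y_d$ of some extension of $y_d$ as above, $$\left\{I-G_1(s)\left[G_1^{\mathsf T}(s)G_1(s)\right]^{-1}G_1^{\mathsf T}(s)\right\}\left[Y_d(s)-G_2(s)D(s)\right]=0.$$ Further, every trackable $y_d$ is generated by a continuous input on $[0,T]$, and every input that generates $y_d$ equals it almost everywhere on $[0,T]$. 2. Let $q\le p$ and let $CB$ have full row rank. Then $y_d$ is trackable if and only if $y_d(0)=Cx_0$. If moreover $q<p$, every trackable $y_d$ is generated by at least two continuous inputs on $[0,T]$ that do not agree almost everywhere on $[0,T]$. -/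

import Mathlib

open Set MeasureTheory
open scoped Matrix

noncomputable section

namespace ILC

/-- A signal `f` on `[0, ∞)` has a Laplace transform: `e^{-σ t} f(t)` is integrable on `[0, ∞)` for
some real `σ`. The values of `f` at negative times play no role. -/
def LaplaceTransformable {m : ℕ} (f : ℝ → Fin m → ℝ) : Prop :=
  ∃ σ : ℝ, ∀ i, IntegrableOn (fun t : ℝ => Real.exp (-(σ * t)) * f t i) (Ici 0)

/-- The (one-sided) Laplace transform `F(s) = ∫₀^∞ e^{-st} f(t) dt` of a vector signal. -/
def laplace {m : ℕ} (f : ℝ → Fin m → ℝ) (s : ℂ) : Fin m → ℂ :=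
  fun i => ∫ t in Ici (0 : ℝ), Complex.exp (-(s * (t : ℂ))) * ((f t i : ℝ) : ℂ)

/-- Equality of two expressions in the Laplace variable `s`: they agree on some right half-plane
(where all the transforms converge and no transfer function has a pole). -/
def FreqEq {m : ℕ} (F G : ℂ → Fin m → ℂ) : Prop :=
  ∃ σ : ℝ, ∀ s : ℂ, σ < s.re → F s = G s

/-- `g` is an extension to `[0, ∞)`, possessing a Laplace transform, of the signal `f`
given on `[0, T]`. -/
def IsLaplaceExtension {m : ℕ} (T : ℝ) (f g : ℝ → Fin m → ℝ) : Prop :=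
  LaplaceTransformable g ∧ EqOn g f (Icc 0 T)

section System

variable {p q : ℕ} {ι : Type*} [Fintype ι]

/-- The input `u` on `[0, T]` generates the output `y` on `[0, T]` in the system
`Y = G₁ U + G₂ D`: the equation `G₁(s) U(s) = Y(s) - G₂(s) D(s)` holds, the signals on the
finite interval `[0, T]` having Laplace transforms through extensions to `[0, ∞)`. -/
def Generates (G₁ : ℂ → Matrix (Fin q) (Fin p) ℂ) (G₂ : ℂ → Matrix (Fin q) ι ℂ) (D : ℂ → ι → ℂ)
    (T : ℝ) (u : ℝ → Fin p → ℝ) (y : ℝ → Fin q → ℝ) : Prop :=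
  ∃ (u' : ℝ → Fin p → ℝ) (y' : ℝ → Fin q → ℝ),
    IsLaplaceExtension T u u' ∧ IsLaplaceExtension T y y' ∧
    FreqEq (fun s => G₁ s *ᵥ laplace u' s) (fun s => laplace y' s - G₂ s *ᵥ D s)

/-- The trajectory `y` on `[0, T]` is trackable: some input generates it. -/
def IsTrackable (G₁ : ℂ → Matrix (Fin q) (Fin p) ℂ) (G₂ : ℂ → Matrix (Fin q) ι ℂ) (D : ℂ → ι → ℂ)
    (T : ℝ) (y : ℝ → Fin q → ℝ) : Prop :=
  ∃ u : ℝ → Fin p → ℝ, Generates G₁ G₂ D T u y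

/-- The projection equation `{I - G₁ (G₁ᵀ G₁)⁻¹ G₁ᵀ} (Y - G₂ D) = 0` for the trajectory `y`
on `[0, T]`. -/
def SatisfiesProjectionEq (G₁ : ℂ → Matrix (Fin q) (Fin p) ℂ) (G₂ : ℂ → Matrix (Fin q) ι ℂ)
    (D : ℂ → ι → ℂ) (T : ℝ) (y : ℝ → Fin q → ℝ) : Prop :=
  ∃ y' : ℝ → Fin q → ℝ, IsLaplaceExtension T y y' ∧
    FreqEq (fun s => (1 - G₁ s * ((G₁ s)ᵀ * G₁ s)⁻¹ * (G₁ s)ᵀ) *ᵥ (laplace y' s - G₂ s *ᵥ D s))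
      (fun _ => 0)

end System

section StateSpace

variable {n p q : ℕ}

/-- `(sI - A)⁻¹`. -/
def resolventMatrix (A : Matrix (Fin n) (Fin n) ℝ) (s : ℂ) : Matrix (Fin n) (Fin n) ℂ :=
  (s • (1 : Matrix (Fin n) (Fin n) ℂ) - A.map (fun r : ℝ => (r : ℂ)))⁻¹

/-- `G₁(s) = C (sI - A)⁻¹ B`. -/
def transferInput (A : Matrix (Fin n) (Fin n) ℝ) (B : Matrix (Fin n) (Fin p) ℝ)
    (C : Matrix (Fin q) (Fin n) ℝ) (s : ℂ) : Matrix (Fin q) (Fin p) ℂ :=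
  C.map (fun r : ℝ => (r : ℂ)) * resolventMatrix A s * B.map (fun r : ℝ => (r : ℂ))

/-- `G₂(s) = [C (sI - A)⁻¹  C (sI - A)⁻¹]`. -/
def transferDisturbance (A : Matrix (Fin n) (Fin n) ℝ) (C : Matrix (Fin q) (Fin n) ℝ) (s : ℂ) :
    Matrix (Fin q) (Fin n ⊕ Fin n) ℂ :=
  Matrix.fromCols (C.map (fun r : ℝ => (r : ℂ)) * resolventMatrix A s)
    (C.map (fun r : ℝ => (r : ℂ)) * resolventMatrix A s)

/-- `D(s) = [x₀; W(s)]`, with `W` the Laplace transform of the disturbance `w`. -/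
def disturbance (x₀ : Fin n → ℝ) (w : ℝ → Fin n → ℝ) (s : ℂ) : Fin n ⊕ Fin n → ℂ :=
  Sum.elim (fun i => ((x₀ i : ℝ) : ℂ)) (laplace w s)

/-- `u` generates `y` on `[0, T]` in `x' = A x + B u + w`, `y = C x`, `x(0) = x₀`. -/
def SSGenerates (A : Matrix (Fin n) (Fin n) ℝ) (B : Matrix (Fin n) (Fin p) ℝ)
    (C : Matrix (Fin q) (Fin n) ℝ) (x₀ : Fin n → ℝ) (w : ℝ → Fin n → ℝ)
    (T : ℝ) (u : ℝ → Fin p → ℝ) (y : ℝ → Fin q → ℝ) : Prop :=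
  Generates (transferInput A B C) (transferDisturbance A C) (disturbance x₀ w) T u y

/-- `y` is trackable on `[0, T]` for `x' = A x + B u + w`, `y = C x`, `x(0) = x₀`. -/
def SSTrackable (A : Matrix (Fin n) (Fin n) ℝ) (B : Matrix (Fin n) (Fin p) ℝ)
    (C : Matrix (Fin q) (Fin n) ℝ) (x₀ : Fin n → ℝ) (w : ℝ → Fin n → ℝ)
    (T : ℝ) (y : ℝ → Fin q → ℝ) : Prop :=
  IsTrackable (transferInput A B C) (transferDisturbance A C) (disturbance x₀ w) T y

/-- The projection equation for `x' = A x + B u + w`, `y = C x`, `x(0) = x₀`. -/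
def SSProjectionEq (A : Matrix (Fin n) (Fin n) ℝ) (B : Matrix (Fin n) (Fin p) ℝ)
    (C : Matrix (Fin q) (Fin n) ℝ) (x₀ : Fin n → ℝ) (w : ℝ → Fin n → ℝ)
    (T : ℝ) (y : ℝ → Fin q → ℝ) : Prop :=
  SatisfiesProjectionEq (transferInput A B C) (transferDisturbance A C) (disturbance x₀ w) T y

end StateSpace

end ILC

end

/-!
Write `A'` for the closed-loop matrix `A - B M C A` and `G₂ D = C Ξ`, where `Ξ` is the transform of
the free response `ξ` to `x₀` and `w`. The whole argument is linear algebra over the Laplace variable,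
on top of four facts about transforms: the convolution theorem (`transformable_convolution`),
Lerch's uniqueness theorem (`ae_eq_zero_of_scalarLaplace_eq_zero`, a consequence of the injectivity
of characteristic functions of finite measures), the equivalence of `X = (sI - A)⁻¹ F` with
`s X = A X + F` (`eventually_eq_resolvent_iff`), and the existence of a continuous, causal signal
with transform `(sI - A)⁻¹ F` (`IsLaplacePair.exists_response`). Causality is what allows statements
about `[0, T]` to be read off from transforms of arbitrary extensions.

A `C¹` trajectory `y` with `y(0) = C x₀` has an extension `Y` with `Y - G₂ D = Z / s`, for a signal
`z` continuous on `[0, T]` (`exists_extension_eq_primitive`). The natural candidate for an input is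
`u = M (z - C A x)` where `x' = A x + B u`, with `M` a one-sided inverse of `C B`
(`exists_feedback_input`).

* If `C B M = 1`, then `s C X = C A X + C B U = Z`, so `u` generates `y`. Replacing `M z` by `M z + k`
  with `C B k = 0` gives a second input, which differs from the first at time `0`.
* If `M C B = 1`, any state `X` of a system at rest with output `V = C X` satisfies
  `s X = A' X + s B M V`, hence `X = B M V + A' (sI - A')⁻¹ B M V`
  (`state_eq_of_left_inverse`, `eventually_eq_add_mulVec_resolvent`): on `[0, T]` the state, and with
  it the input, is determined by the output on `[0, T]`, which is uniqueness. The projection equation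
  says that `V = Y₁ - G₂ D` lies in the range of `G₁(s)` for some extension `Y₁` of `y`; comparing the
  formula for this `V` with that for the candidate input shows that the output of the candidate
  differs from `y` only after time `T`. Conversely `G₁ U` is killed by the projection, because
  `G₁ᵀ G₁` is invertible for large `re s` (`eventually_isUnit_transpose_mul_self`).

The condition `y(0) = C x₀` is necessary because outputs of the system are continuous and start at
`C x₀`.
-/

namespace ILC

open Filter Topology

/-! ### Laplace transforms of scalar signals -/

/-- The filter of right half-planes: a property holds eventually along it if it holds on
`{s | σ < re s}` for some `σ`. -/
def rightHalfPlanes : Filter ℂ := comap Complex.re atTop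

theorem eventually_rightHalfPlanes {P : ℂ → Prop} :
    (∀ᶠ s in rightHalfPlanes, P s) ↔ ∃ σ : ℝ, ∀ s : ℂ, σ < s.re → P s :=
  (atTop_basis_Ioi.comap Complex.re).eventually_iff.trans (by simp)

theorem freqEq_iff {m : ℕ} {F G : ℂ → Fin m → ℂ} :
    FreqEq F G ↔ ∀ᶠ s in rightHalfPlanes, F s = G s :=
  eventually_rightHalfPlanes.symm

/-- The integrand `e^{-st} f(t)` of the Laplace transform. -/
noncomputable def laplaceIntegrand (f : ℝ → ℝ) (s : ℂ) (t : ℝ) : ℂ := Complex.exp (-(s * t)) * f t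

/-- The Laplace integral of the scalar signal `f` converges absolutely on some right half-plane. -/
def Transformable (f : ℝ → ℝ) : Prop :=
  ∀ᶠ s in rightHalfPlanes, IntegrableOn (laplaceIntegrand f s) (Ici 0)

/-- The Laplace transform of a scalar signal. -/
noncomputable def scalarLaplace (f : ℝ → ℝ) (s : ℂ) : ℂ := ∫ t in Ici (0 : ℝ), laplaceIntegrand f s t

theorem laplaceIntegrand_ofReal (f : ℝ → ℝ) (σ t : ℝ) :
    laplaceIntegrand f σ t = ((Real.exp (-(σ * t)) * f t : ℝ) : ℂ) := by
  simp [laplaceIntegrand]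

theorem transformable_of_integrableOn {f : ℝ → ℝ} {σ : ℝ}
    (h : IntegrableOn (fun t : ℝ => Real.exp (-(σ * t)) * f t) (Ici 0)) : Transformable f := by
  refine eventually_rightHalfPlanes.2 ⟨σ, fun s hs => ?_⟩
  have h2 : IntegrableOn (fun t : ℝ => Complex.exp (-((s - σ) * t)) *
      ((Real.exp (-(σ * t)) * f t : ℝ) : ℂ)) (Ici 0) := by
    refine Integrable.bdd_mul (c := 1) h.ofReal (by fun_prop) ?_
    filter_upwards [ae_restrict_mem measurableSet_Ici] with t (ht : 0 ≤ t)
    rw [Complex.norm_exp, Real.exp_le_one_iff]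
    simp only [Complex.neg_re, Complex.mul_re, Complex.sub_re, Complex.ofReal_re, Complex.sub_im,
      Complex.ofReal_im, mul_zero, sub_zero]
    nlinarith
  refine h2.congr_fun (fun t _ => ?_) measurableSet_Ici
  simp only [laplaceIntegrand]
  push_cast
  rw [← mul_assoc, ← Complex.exp_add]
  congr 2
  ring

theorem Transformable.eventually_atTop {f : ℝ → ℝ} (hf : Transformable f) :
    ∀ᶠ σ : ℝ in atTop, IntegrableOn (fun t : ℝ => Real.exp (-(σ * t)) * f t) (Ici 0) := by
  obtain ⟨σ, h⟩ := eventually_rightHalfPlanes.1 hf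
  filter_upwards [eventually_gt_atTop σ] with τ hτ
  have : IntegrableOn (fun t => (laplaceIntegrand f τ t).re) (Ici 0) :=
    Integrable.re (h τ (by simpa using hτ))
  refine this.congr_fun (fun t _ => ?_) measurableSet_Ici
  change (laplaceIntegrand f τ t).re = _
  rw [laplaceIntegrand_ofReal, Complex.ofReal_re]

theorem laplaceTransformable_iff {m : ℕ} {f : ℝ → Fin m → ℝ} :
    LaplaceTransformable f ↔ ∀ i, Transformable (fun t => f t i) :=
  ⟨fun ⟨_, h⟩ i => transformable_of_integrableOn (h i),
    fun h => (eventually_all.2 fun i => (h i).eventually_atTop).exists⟩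

theorem laplace_apply {m : ℕ} (f : ℝ → Fin m → ℝ) (s : ℂ) (i : Fin m) :
    laplace f s i = scalarLaplace (fun t => f t i) s := rfl

theorem Transformable.integrableOn_Icc {f : ℝ → ℝ} (hf : Transformable f) (T : ℝ) :
    IntegrableOn f (Icc 0 T) := by
  obtain ⟨σ, hσ⟩ := hf.eventually_atTop.exists
  have h1 := (hσ.mono_set (Icc_subset_Ici_self : Icc 0 T ⊆ Ici 0)).continuousOn_mul
    (g := fun t => Real.exp (σ * t)) (by fun_prop) isCompact_Icc
  refine h1.congr_fun (fun t _ => ?_) measurableSet_Icc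
  simp only
  rw [← mul_assoc, ← Real.exp_add]
  simp

theorem transformable_of_eqOn_zero {f : ℝ → ℝ} {T : ℝ} (hf : IntegrableOn f (Icc 0 T))
    (h0 : ∀ t, T < t → f t = 0) : Transformable f := by
  refine transformable_of_integrableOn (σ := 0) ?_
  simp only [zero_mul, neg_zero, Real.exp_zero, one_mul]
  refine IntegrableOn.of_forall_sdiff_eq_zero hf measurableSet_Ici (fun t ht => h0 t ?_)
  by_contra hc
  exact ht.2 ⟨ht.1, not_lt.1 hc⟩

theorem Transformable.add {f g : ℝ → ℝ} (hf : Transformable f) (hg : Transformable g) :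
    Transformable (fun t => f t + g t) := by
  filter_upwards [hf, hg] with s h1 h2
  exact (h1.add h2).congr (ae_of_all _ fun t => by simp [laplaceIntegrand, mul_add])

theorem Transformable.const_mul {f : ℝ → ℝ} (hf : Transformable f) (c : ℝ) :
    Transformable (fun t => c * f t) := by
  filter_upwards [hf] with s h1
  exact (h1.const_mul (c : ℂ)).congr
    (ae_of_all _ fun t => by simp [laplaceIntegrand, mul_left_comm])

theorem transformable_zero : Transformable (fun _ => 0) :=
  transformable_of_integrableOn (σ := 0) (by simp)

theorem transformable_sum {ι : Type*} (S : Finset ι) {f : ι → ℝ → ℝ}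
    (hf : ∀ i, Transformable (f i)) : Transformable (fun t => ∑ i ∈ S, f i t) := by
  classical
  induction S using Finset.induction_on with
  | empty => simpa using transformable_zero
  | insert a S ha ih => simpa [Finset.sum_insert ha] using (hf a).add ih

theorem scalarLaplace_add {f g : ℝ → ℝ} (hf : Transformable f) (hg : Transformable g) :
    ∀ᶠ s in rightHalfPlanes,
      scalarLaplace (fun t => f t + g t) s = scalarLaplace f s + scalarLaplace g s := by
  filter_upwards [hf, hg] with s h1 h2
  rw [scalarLaplace, scalarLaplace, scalarLaplace, ← integral_add h1 h2]
  simp [laplaceIntegrand, mul_add]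

theorem scalarLaplace_const_mul (f : ℝ → ℝ) (c : ℝ) (s : ℂ) :
    scalarLaplace (fun t => c * f t) s = c * scalarLaplace f s := by
  rw [scalarLaplace, scalarLaplace, ← integral_const_mul]
  simp [laplaceIntegrand, mul_left_comm]

theorem scalarLaplace_sum {ι : Type*} (S : Finset ι) {f : ι → ℝ → ℝ}
    (hf : ∀ i, Transformable (f i)) : ∀ᶠ s in rightHalfPlanes,
      scalarLaplace (fun t => ∑ i ∈ S, f i t) s = ∑ i ∈ S, scalarLaplace (f i) s := by
  classical
  induction S using Finset.induction_on with
  | empty => simp [scalarLaplace, laplaceIntegrand]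
  | insert a S ha ih =>
    filter_upwards [ih, scalarLaplace_add (hf a) (transformable_sum S hf)] with s h1 h2
    simp [Finset.sum_insert ha, ← h1, ← h2]

theorem transformable_const (c : ℝ) : Transformable (fun _ => c) :=
  transformable_of_integrableOn (σ := 1) (by
    rw [integrableOn_Ici_iff_integrableOn_Ioi]
    simpa [IntegrableOn] using (integrableOn_exp_neg_Ioi 0).mul_const c)

theorem scalarLaplace_const (c : ℝ) :
    ∀ᶠ s in rightHalfPlanes, scalarLaplace (fun _ => c) s = s⁻¹ * c := by
  refine eventually_rightHalfPlanes.2 ⟨0, fun s hs => ?_⟩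
  have h := integral_exp_mul_complex_Ioi (a := -s) (by simpa using hs) 0
  simp only [scalarLaplace, laplaceIntegrand, integral_Ici_eq_integral_Ioi, integral_mul_const]
  rw [show (fun t : ℝ => Complex.exp (-(s * t))) = fun t : ℝ => Complex.exp (-s * t) by simp, h]
  simp

/-- The convolution theorem: the Laplace transform turns the one-sided convolution of two signals
into the product of their transforms. -/
theorem transformable_convolution {f k : ℝ → ℝ} (hf : Transformable f) (hk : Transformable k) :
    Transformable (fun t => ∫ τ in (0 : ℝ)..t, f τ * k (t - τ)) ∧
    ∀ᶠ s in rightHalfPlanes, scalarLaplace (fun t => ∫ τ in (0 : ℝ)..t, f τ * k (t - τ)) s =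
      scalarLaplace f s * scalarLaplace k s := by
  have key : ∀ (s : ℂ) (t : ℝ),
      (∫ τ in (0 : ℝ)..t, ContinuousLinearMap.mul ℝ ℂ (laplaceIntegrand f s τ)
        (laplaceIntegrand k s (t - τ))) =
      laplaceIntegrand (fun t => ∫ τ in (0 : ℝ)..t, f τ * k (t - τ)) s t := by
    intro s t
    rw [laplaceIntegrand, ← intervalIntegral.integral_ofReal, ← intervalIntegral.integral_const_mul]
    congr 1 with τ
    rw [show -(s * (t : ℂ)) = -(s * τ) + -(s * (t - τ)) by ring, Complex.exp_add]
    simp only [laplaceIntegrand, ContinuousLinearMap.mul_apply']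
    push_cast
    ring
  constructor
  · filter_upwards [hf, hk] with s h1 h2
    rw [integrableOn_Ici_iff_integrableOn_Ioi] at h1 h2 ⊢
    have := integrable_posConvolution h1 h2 (ContinuousLinearMap.mul ℝ ℂ)
    rw [posConvolution, integrable_indicator_iff measurableSet_Ioi] at this
    simpa only [key] using this
  · filter_upwards [hf, hk] with s h1 h2
    rw [integrableOn_Ici_iff_integrableOn_Ioi] at h1 h2
    have := integral_posConvolution h1 h2 (ContinuousLinearMap.mul ℝ ℂ)
    simp only [key] at this
    simpa only [ContinuousLinearMap.mul_apply', scalarLaplace, integral_Ici_eq_integral_Ioi]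
      using this

theorem transformable_primitive {f : ℝ → ℝ} (hf : Transformable f) :
    Transformable (fun t => ∫ τ in (0 : ℝ)..t, f τ) := by
  simpa using (transformable_convolution hf (transformable_const 1)).1

theorem scalarLaplace_primitive {f : ℝ → ℝ} (hf : Transformable f) : ∀ᶠ s in rightHalfPlanes,
    scalarLaplace (fun t => ∫ τ in (0 : ℝ)..t, f τ) s = s⁻¹ * scalarLaplace f s := by
  filter_upwards [(transformable_convolution hf (transformable_const 1)).2,
    scalarLaplace_const 1] with s h1 h2
  simpa [h2, mul_comm] using h1

/-- An integrable function on the line whose Fourier integral vanishes is zero almost everywhere. -/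
theorem ae_eq_zero_of_fourier_eq_zero {g : ℝ → ℝ} (hg : Integrable g)
    (h : ∀ ω : ℝ, ∫ t : ℝ, Complex.exp (ω * t * Complex.I) * g t = 0) : g =ᵐ[volume] 0 := by
  -- The positive and negative parts of `g` are densities of finite measures with the same
  -- characteristic function.
  have hchar : ∀ {r : ℝ → ℝ}, Integrable r → ∀ ω : ℝ,
      charFun (volume.withDensity fun t => ENNReal.ofReal (r t)) ω =
        ∫ t : ℝ, Complex.exp (ω * t * Complex.I) * (max (r t) 0 : ℝ) := by
    intro r hr ω
    rw [charFun_apply_real, integral_withDensity_eq_integral_toReal_smul₀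
      hr.aestronglyMeasurable.aemeasurable.ennreal_ofReal (ae_of_all _ fun _ => by simp)]
    congr 1 with t
    rw [ENNReal.toReal_ofReal', Complex.real_smul, mul_comm]
  have hint : ∀ {r : ℝ → ℝ}, Integrable r → ∀ ω : ℝ,
      Integrable fun t : ℝ => Complex.exp (ω * t * Complex.I) * (max (r t) 0 : ℝ) := by
    intro r hr ω
    refine Integrable.bdd_mul (c := 1) hr.pos_part.ofReal (by fun_prop) (ae_of_all _ fun t => ?_)
    rw [← Complex.ofReal_mul, Complex.norm_exp_ofReal_mul_I]
  have := isFiniteMeasure_withDensity_ofReal hg.2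
  have := isFiniteMeasure_withDensity_ofReal hg.neg.2
  have hμ : (volume.withDensity fun t => ENNReal.ofReal (g t)) =
      volume.withDensity fun t => ENNReal.ofReal ((-g) t) := by
    refine Measure.ext_of_charFun (funext fun ω => ?_)
    rw [hchar hg, hchar hg.neg, ← sub_eq_zero, ← integral_sub (hint hg ω) (hint hg.neg ω), ← h ω]
    congr 1 with t
    rw [← mul_sub, ← Complex.ofReal_sub]
    congr 2
    rcases le_total (g t) 0 with h0 | h0 <;> simp [h0]
  have hg' := hg.aestronglyMeasurable.aemeasurable
  have h3 := (withDensity_eq_iff_of_sigmaFinite hg'.ennreal_ofReal hg'.neg.ennreal_ofReal).1 hμ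
  filter_upwards [h3] with t ht
  rcases le_total (g t) 0 with h0 | h0
  · rw [ENNReal.ofReal_of_nonpos h0] at ht
    have := ENNReal.ofReal_eq_zero.1 ht.symm
    simp only [Pi.neg_apply] at this
    simp only [Pi.zero_apply]
    linarith
  · rw [ENNReal.ofReal_of_nonpos (p := (-g) t) (by simpa using h0)] at ht
    have := ENNReal.ofReal_eq_zero.1 ht
    simp only [Pi.zero_apply]
    linarith

/-- Lerch's theorem: a signal is determined almost everywhere on `[0, ∞)` by its transform. -/
theorem ae_eq_zero_of_scalarLaplace_eq_zero {f : ℝ → ℝ} (hf : Transformable f)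
    (h : ∀ᶠ s in rightHalfPlanes, scalarLaplace f s = 0) : ∀ᵐ t, 0 ≤ t → f t = 0 := by
  obtain ⟨σ₁, h1⟩ := eventually_rightHalfPlanes.1 h
  obtain ⟨σ, hσ, hint⟩ := ((eventually_gt_atTop σ₁).and hf.eventually_atTop).exists
  have h2 : indicator (Ici 0) (fun t : ℝ => Real.exp (-(σ * t)) * f t) =ᵐ[volume] 0 := by
    refine ae_eq_zero_of_fourier_eq_zero (hint.integrable_indicator measurableSet_Ici) fun ω => ?_
    have h3 := h1 (σ - ω * Complex.I) (by simpa using hσ)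
    rw [scalarLaplace, ← integral_indicator measurableSet_Ici] at h3
    rw [← h3]
    congr 1 with t
    by_cases ht : t ∈ Ici (0 : ℝ)
    · simp only [indicator_of_mem ht, laplaceIntegrand]
      push_cast
      rw [← mul_assoc, ← Complex.exp_add]
      congr 2
      ring
    · simp [indicator_of_notMem ht]
  filter_upwards [h2] with t ht h0
  simpa [indicator_of_mem (show t ∈ Ici (0 : ℝ) from h0)] using ht

/-! ### Calculus of transform pairs -/

/-- The entrywise complexification of a real matrix. -/
def complexify {m n : ℕ} (M : Matrix (Fin m) (Fin n) ℝ) : Matrix (Fin m) (Fin n) ℂ :=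
  M.map (fun r : ℝ => (r : ℂ))

@[simp]
theorem complexify_apply {m n : ℕ} (M : Matrix (Fin m) (Fin n) ℝ) (i : Fin m) (j : Fin n) :
    complexify M i j = (M i j : ℂ) := rfl

theorem complexify_mul {l m n : ℕ} (M : Matrix (Fin l) (Fin m) ℝ) (N : Matrix (Fin m) (Fin n) ℝ) :
    complexify (M * N) = complexify M * complexify N :=
  Matrix.map_mul (f := Complex.ofRealHom)

theorem complexify_sub {m n : ℕ} (M N : Matrix (Fin m) (Fin n) ℝ) :
    complexify (M - N) = complexify M - complexify N := by
  ext; simp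

theorem complexify_one {n : ℕ} : complexify (1 : Matrix (Fin n) (Fin n) ℝ) = 1 :=
  Matrix.map_one _ Complex.ofReal_zero Complex.ofReal_one

/-- The vector signal `f` is transformable, with Laplace transform `F` on some right half-plane. -/
def IsLaplacePair {m : ℕ} (f : ℝ → Fin m → ℝ) (F : ℂ → Fin m → ℂ) : Prop :=
  LaplaceTransformable f ∧ ∀ᶠ s in rightHalfPlanes, laplace f s = F s

theorem LaplaceTransformable.isLaplacePair {m : ℕ} {f : ℝ → Fin m → ℝ}
    (hf : LaplaceTransformable f) : IsLaplacePair f (laplace f) :=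
  ⟨hf, Eventually.of_forall fun _ => rfl⟩

theorem isLaplacePair_iff {m : ℕ} {f : ℝ → Fin m → ℝ} {F : ℂ → Fin m → ℂ} :
    IsLaplacePair f F ↔ ∀ i, Transformable (fun t => f t i) ∧
      ∀ᶠ s in rightHalfPlanes, scalarLaplace (fun t => f t i) s = F s i := by
  simp only [IsLaplacePair, laplaceTransformable_iff, funext_iff, eventually_all, forall_and,
    laplace_apply]

theorem IsLaplacePair.congr {m : ℕ} {f : ℝ → Fin m → ℝ} {F G : ℂ → Fin m → ℂ}
    (hf : IsLaplacePair f F) (h : ∀ᶠ s in rightHalfPlanes, F s = G s) : IsLaplacePair f G :=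
  ⟨hf.1, by filter_upwards [hf.2, h] with s h1 h2 using h1.trans h2⟩

theorem IsLaplacePair.add {m : ℕ} {f g : ℝ → Fin m → ℝ} {F G : ℂ → Fin m → ℂ}
    (hf : IsLaplacePair f F) (hg : IsLaplacePair g G) :
    IsLaplacePair (fun t => f t + g t) (fun s => F s + G s) := by
  rw [isLaplacePair_iff] at *
  refine fun i => ⟨(hf i).1.add (hg i).1, ?_⟩
  filter_upwards [(hf i).2, (hg i).2, scalarLaplace_add (hf i).1 (hg i).1] with s h1 h2 h3
  simpa [h1, h2] using h3

theorem IsLaplacePair.mulVec {m n : ℕ} {f : ℝ → Fin n → ℝ} {F : ℂ → Fin n → ℂ}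
    (hf : IsLaplacePair f F) (M : Matrix (Fin m) (Fin n) ℝ) :
    IsLaplacePair (fun t => M *ᵥ f t) (fun s => complexify M *ᵥ F s) := by
  rw [isLaplacePair_iff] at *
  intro i
  have h (j : Fin n) : Transformable (fun t => M i j * f t j) := (hf j).1.const_mul _
  simp only [Matrix.mulVec, dotProduct, complexify_apply]
  refine ⟨transformable_sum Finset.univ h, ?_⟩
  filter_upwards [scalarLaplace_sum Finset.univ h, eventually_all.2 fun j => (hf j).2]
    with s h1 h2
  rw [h1]
  simp only [scalarLaplace_const_mul, h2]

theorem IsLaplacePair.sub {m : ℕ} {f g : ℝ → Fin m → ℝ} {F G : ℂ → Fin m → ℂ}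
    (hf : IsLaplacePair f F) (hg : IsLaplacePair g G) :
    IsLaplacePair (fun t => f t - g t) (fun s => F s - G s) := by
  have h := hf.add (hg.mulVec (-1))
  have h1 : complexify (-1 : Matrix (Fin m) (Fin m) ℝ) = -1 := by
    rw [← zero_sub, complexify_sub, complexify_one, ← zero_sub]
    congr 1
  simpa only [h1, Matrix.neg_mulVec, Matrix.one_mulVec, ← sub_eq_add_neg] using h

/-- The entrywise complexification of a real vector. -/
def complexVec {m : ℕ} (c : Fin m → ℝ) : Fin m → ℂ := fun i => (c i : ℂ)

theorem complexVec_mulVec {m n : ℕ} (M : Matrix (Fin m) (Fin n) ℝ) (c : Fin n → ℝ) :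
    complexVec (M *ᵥ c) = complexify M *ᵥ complexVec c := by
  ext i
  simp [complexVec, Matrix.mulVec, dotProduct]

theorem isLaplacePair_const {m : ℕ} (c : Fin m → ℝ) :
    IsLaplacePair (fun _ => c) (fun s => s⁻¹ • complexVec c) :=
  isLaplacePair_iff.2 fun i => ⟨transformable_const (c i), scalarLaplace_const (c i)⟩

theorem continuousOn_mulVec {l m : ℕ} (M : Matrix (Fin l) (Fin m) ℝ) {f : ℝ → Fin m → ℝ}
    {S : Set ℝ} (hf : ContinuousOn f S) : ContinuousOn (fun t => M *ᵥ f t) S :=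
  (Matrix.mulVecLin M).continuous_of_finiteDimensional.comp_continuousOn hf

/-- The componentwise primitive vanishing at `0`. -/
noncomputable def primitive {m : ℕ} (f : ℝ → Fin m → ℝ) (t : ℝ) : Fin m → ℝ :=
  fun i => ∫ τ in (0 : ℝ)..t, f τ i

theorem IsLaplacePair.primitive {m : ℕ} {f : ℝ → Fin m → ℝ} {F : ℂ → Fin m → ℂ}
    (hf : IsLaplacePair f F) : IsLaplacePair (primitive f) (fun s => s⁻¹ • F s) := by
  rw [isLaplacePair_iff] at *
  refine fun i => ⟨transformable_primitive (hf i).1, ?_⟩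
  filter_upwards [(hf i).2, scalarLaplace_primitive (hf i).1] with s h1 h2
  rw [Pi.smul_apply, smul_eq_mul, ← h1]
  exact h2

theorem primitive_zero {m : ℕ} (f : ℝ → Fin m → ℝ) : primitive f 0 = 0 := by
  ext; simp [primitive]

theorem continuousOn_primitive_of_transformable {m : ℕ} {f : ℝ → Fin m → ℝ}
    (hf : LaplaceTransformable f) (T : ℝ) : ContinuousOn (primitive f) (Icc 0 T) := by
  rw [laplaceTransformable_iff] at hf
  refine continuousOn_pi.2 fun i => ?_
  rcases le_or_gt 0 T with hT | hT
  · have h := (hf i).integrableOn_Icc T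
    rw [← uIcc_of_le hT] at h ⊢
    exact intervalIntegral.continuousOn_primitive_interval h
  · simp [Icc_eq_empty_of_lt hT]

theorem primitive_eq_zero {m : ℕ} {f : ℝ → Fin m → ℝ} {T : ℝ} (h : ∀ t ∈ Icc 0 T, f t = 0) :
    ∀ t ∈ Icc 0 T, primitive f t = 0 := by
  intro t ht
  ext i
  refine intervalIntegral.integral_zero_ae (ae_of_all _ fun τ hτ => ?_)
  rw [uIoc_of_le ht.1] at hτ
  simp [h τ ⟨hτ.1.le, hτ.2.trans ht.2⟩]

/-- Lerch's theorem for transform pairs. -/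
theorem IsLaplacePair.ae_eq {m : ℕ} {f g : ℝ → Fin m → ℝ} {F : ℂ → Fin m → ℂ}
    (hf : IsLaplacePair f F) (hg : IsLaplacePair g F) : ∀ᵐ t, 0 ≤ t → f t = g t := by
  have h := isLaplacePair_iff.1 (hf.sub hg)
  have h2 := ae_all_iff.2 fun i => ae_eq_zero_of_scalarLaplace_eq_zero (h i).1
    (by simpa using (h i).2)
  filter_upwards [h2] with t ht h0
  ext i
  simpa [sub_eq_zero] using ht i h0

theorem IsLaplacePair.eqOn {m : ℕ} {f g : ℝ → Fin m → ℝ} {F : ℂ → Fin m → ℂ} {T : ℝ} (hT : 0 < T)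
    (hf : IsLaplacePair f F) (hg : IsLaplacePair g F) (hfc : ContinuousOn f (Icc 0 T))
    (hgc : ContinuousOn g (Icc 0 T)) : EqOn f g (Icc 0 T) := by
  refine Measure.eqOn_Icc_of_ae_eq volume hT.ne ?_ hfc hgc
  filter_upwards [ae_restrict_of_ae (hf.ae_eq hg), ae_restrict_mem measurableSet_Icc]
    with t h1 h2 using h1 h2.1

/-- A signal whose primitive vanishes on `[0, T]` vanishes almost everywhere there. -/
theorem ae_eq_zero_of_primitive_eq_zero {m : ℕ} {f : ℝ → Fin m → ℝ} {T : ℝ} (hT : 0 < T)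
    (hf : LaplaceTransformable f) (h : ∀ t ∈ Icc 0 T, primitive f t = 0) :
    ∀ᵐ t ∂volume.restrict (Icc 0 T), f t = 0 := by
  rw [laplaceTransformable_iff] at hf
  have hi (i : Fin m) : ∀ᵐ t, t ∈ Icc 0 T → f t i = 0 := by
    have h1 := (intervalIntegrable_iff_integrableOn_Icc_of_le hT.le).2 ((hf i).integrableOn_Icc T)
    have h0 : ∀ᵐ t : ℝ, t ≠ T := by simp [ae_iff]
    have h00 : ∀ᵐ t : ℝ, t ≠ 0 := by simp [ae_iff]
    filter_upwards [h1.ae_hasDerivAt_integral, h0, h00] with t ht hne hne' htm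
    have h2 := ht (uIcc_of_le hT.le ▸ htm) 0 (uIcc_of_le hT.le ▸ left_mem_Icc.2 hT.le)
    refine h2.unique ((hasDerivAt_const t (0 : ℝ)).congr_of_eventuallyEq ?_)
    filter_upwards [Icc_mem_nhds (htm.1.lt_of_ne hne'.symm) (htm.2.lt_of_ne hne)] with x hx
    exact congrFun (h x hx) i
  rw [ae_restrict_iff' measurableSet_Icc]
  filter_upwards [ae_all_iff.2 hi] with t ht htm
  ext i
  exact ht i htm

/-! ### The resolvent for large real part -/

theorem tendsto_inv_rightHalfPlanes : Tendsto (fun s : ℂ => s⁻¹) rightHalfPlanes (𝓝 0) := by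
  refine tendsto_inv₀_cobounded.comp (tendsto_norm_atTop_iff_cobounded.1 ?_)
  exact tendsto_atTop_mono (fun s => Complex.re_le_norm s) tendsto_comap

theorem eventually_ne_zero : ∀ᶠ s in rightHalfPlanes, s ≠ 0 :=
  eventually_rightHalfPlanes.2 ⟨0, fun s hs h => by simp [h] at hs⟩

theorem smul_one_sub_eq {n : ℕ} (A : Matrix (Fin n) (Fin n) ℂ) {s : ℂ} (hs : s ≠ 0) :
    s • (1 : Matrix (Fin n) (Fin n) ℂ) - A = s • (1 - s⁻¹ • A) := by
  rw [smul_sub, smul_smul, mul_inv_cancel₀ hs, one_smul]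

theorem eventually_det_one_sub_ne_zero {n : ℕ} (A : Matrix (Fin n) (Fin n) ℂ) :
    ∀ᶠ s in rightHalfPlanes, (1 - s⁻¹ • A).det ≠ 0 := by
  have hc : Continuous fun ε : ℂ => (1 - ε • A).det := by fun_prop
  exact tendsto_inv_rightHalfPlanes.eventually
    ((hc.tendsto 0).eventually_ne (by simp))

theorem eventually_isUnit_det {n : ℕ} (A : Matrix (Fin n) (Fin n) ℝ) :
    ∀ᶠ s in rightHalfPlanes, IsUnit (s • (1 : Matrix (Fin n) (Fin n) ℂ) - complexify A).det := by
  filter_upwards [eventually_ne_zero, eventually_det_one_sub_ne_zero (complexify A)] with s h1 h2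
  rw [smul_one_sub_eq _ h1, Matrix.det_smul, isUnit_iff_ne_zero]
  exact mul_ne_zero (pow_ne_zero _ h1) h2

/-- `X = (sI - A)⁻¹ F` is the transformed state equation `s X = A X + F`. -/
theorem eventually_eq_resolvent_iff {n : ℕ} (A : Matrix (Fin n) (Fin n) ℝ) :
    ∀ᶠ s in rightHalfPlanes, ∀ X F : Fin n → ℂ,
      X = resolventMatrix A s *ᵥ F ↔ s • X = complexify A *ᵥ X + F := by
  filter_upwards [eventually_isUnit_det A] with s hs X F
  have h1 : (s • (1 : Matrix (Fin n) (Fin n) ℂ) - complexify A) * resolventMatrix A s = 1 :=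
    Matrix.mul_nonsing_inv _ hs
  have h2 : resolventMatrix A s * (s • (1 : Matrix (Fin n) (Fin n) ℂ) - complexify A) = 1 :=
    Matrix.nonsing_inv_mul _ hs
  have h3 : (s • (1 : Matrix (Fin n) (Fin n) ℂ) - complexify A) *ᵥ X =
      s • X - complexify A *ᵥ X := by
    rw [Matrix.sub_mulVec, Matrix.smul_mulVec, Matrix.one_mulVec]
  rw [add_comm, ← sub_eq_iff_eq_add, ← h3]
  constructor
  · rintro rfl
    rw [Matrix.mulVec_mulVec, h1, Matrix.one_mulVec]
  · rintro rfl
    rw [Matrix.mulVec_mulVec, h2, Matrix.one_mulVec]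

theorem IsLaplacePair.resolvent {n : ℕ} {x : ℝ → Fin n → ℝ} {X F : ℂ → Fin n → ℂ}
    (A : Matrix (Fin n) (Fin n) ℝ) (hx : IsLaplacePair x X)
    (h : ∀ᶠ s in rightHalfPlanes, s • X s = complexify A *ᵥ X s + F s) :
    IsLaplacePair x (fun s => resolventMatrix A s *ᵥ F s) :=
  hx.congr (by
    filter_upwards [eventually_eq_resolvent_iff A, h] with s h1 h2 using (h1 _ _).2 h2)

/-! ### The state response -/

/-- `e^{tA} c` is transformable, with transform `(sI - A)⁻¹ c`. -/
theorem exists_isLaplacePair_resolvent {n : ℕ} (A : Matrix (Fin n) (Fin n) ℝ) (c : Fin n → ℝ) :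
    ∃ k : ℝ → Fin n → ℝ, IsLaplacePair k (fun s => resolventMatrix A s *ᵥ complexVec c) := by
  let a : (Fin n → ℝ) →L[ℝ] (Fin n → ℝ) := A.toLin'.toContinuousLinearMap
  have ha (v) : a v = A *ᵥ v := by simp [a]
  let k : ℝ → Fin n → ℝ := fun t => NormedSpace.exp (t • a) c
  have hd (t : ℝ) : HasDerivAt k (a (k t)) t := by
    have := (hasDerivAt_exp_smul_const' (𝕂 := ℝ) a t).clm_apply (hasDerivAt_const t c)
    simpa [k] using this
  have hk0 : k 0 = c := by simp [k]
  have hcont : Continuous k := continuous_iff_continuousAt.2 fun t => (hd t).continuousAt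
  have hbound (t : ℝ) (ht : 0 ≤ t) : ‖k t‖ ≤ ‖c‖ * Real.exp (‖a‖ * t) := by
    have := norm_le_gronwallBound_of_norm_deriv_right_le (f := k) (f' := fun t => a (k t))
      (δ := ‖c‖) (K := ‖a‖) (ε := 0) (a := 0) (b := t) hcont.continuousOn
      (fun x _ => (hd x).hasDerivWithinAt) (by rw [hk0])
      (fun x _ => by simpa using a.le_opNorm (k x)) t ⟨ht, le_rfl⟩
    simpa [gronwallBound_ε0] using this
  have hk : IsLaplacePair k (laplace k) := by
    refine (LaplaceTransformable.isLaplacePair ⟨‖a‖ + 1, fun i => ?_⟩)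
    refine Integrable.mono' (g := fun t => ‖c‖ * Real.exp (-t)) ?_ ?_ ?_
    · rw [← IntegrableOn, integrableOn_Ici_iff_integrableOn_Ioi]
      exact (integrableOn_exp_neg_Ioi 0).const_mul _
    · exact Continuous.aestronglyMeasurable (by fun_prop)
    · filter_upwards [ae_restrict_mem measurableSet_Ici] with t (ht : 0 ≤ t)
      rw [norm_mul, Real.norm_eq_abs, Real.abs_exp]
      calc Real.exp (-((‖a‖ + 1) * t)) * ‖k t i‖
          ≤ Real.exp (-((‖a‖ + 1) * t)) * (‖c‖ * Real.exp (‖a‖ * t)) := by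
            gcongr
            exact (norm_le_pi_norm _ _).trans (hbound t ht)
        _ = ‖c‖ * Real.exp (-t) := by
            rw [mul_left_comm, ← Real.exp_add]
            ring_nf
  refine ⟨k, hk.resolvent A ?_⟩
  -- The integrated differential equation `k = c + ∫ A k`, transformed.
  have h2 := (isLaplacePair_const c).add (hk.mulVec A).primitive
  have h3 : (fun t => c + primitive (fun t => A *ᵥ k t) t) = k := by
    ext t i
    have := intervalIntegral.integral_eq_sub_of_hasDerivAt (a := 0) (b := t)
      (fun x _ => hasDerivAt_pi.1 (hd x) i)
      (Continuous.intervalIntegrable (by fun_prop) _ _)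
    simp only [ha, hk0] at this
    simp only [Pi.add_apply, primitive, this]
    ring
  rw [h3] at h2
  filter_upwards [h2.2, eventually_ne_zero] with s h4 h5
  have h6 : s • laplace k s = s • (s⁻¹ • complexVec c + s⁻¹ • complexify A *ᵥ laplace k s) :=
    congrArg _ h4
  rw [h6, smul_add, smul_smul, smul_smul, mul_inv_cancel₀ h5, one_smul, one_smul, add_comm]

/-- The state `x` with `x' = A x + f` and `x(0) = 0`: it is continuous, has transform
`(sI - A)⁻¹ F`, and depends causally on `f`. -/
theorem IsLaplacePair.exists_response {n : ℕ} {f : ℝ → Fin n → ℝ} {F : ℂ → Fin n → ℂ}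
    (hf : IsLaplacePair f F) (A : Matrix (Fin n) (Fin n) ℝ) :
    ∃ x : ℝ → Fin n → ℝ, IsLaplacePair x (fun s => resolventMatrix A s *ᵥ F s) ∧
      (∀ T, ContinuousOn x (Icc 0 T)) ∧ x 0 = 0 ∧
      ∀ T, (∀ t ∈ Icc 0 T, f t = 0) → ∀ t ∈ Icc 0 T, x t = 0 := by
  choose k hk using fun j : Fin n => exists_isLaplacePair_resolvent A (Pi.single j 1)
  -- Variation of constants gives the transform and causality; one further integration of the
  -- state equation replaces this representative by a continuous one.
  let x : ℝ → Fin n → ℝ := fun t i => ∑ j, ∫ τ in (0 : ℝ)..t, f τ j * k j (t - τ) i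
  have hx : IsLaplacePair x (fun s => resolventMatrix A s *ᵥ F s) := by
    rw [isLaplacePair_iff] at *
    intro i
    have h (j : Fin n) := transformable_convolution (hf j).1 (isLaplacePair_iff.1 (hk j) i).1
    refine ⟨transformable_sum Finset.univ fun j => (h j).1, ?_⟩
    filter_upwards [scalarLaplace_sum Finset.univ fun j => (h j).1,
      eventually_all.2 fun j => (h j).2, eventually_all.2 fun j => (hf j).2,
      eventually_all.2 fun j => (isLaplacePair_iff.1 (hk j) i).2] with s h1 h2 h3 h4
    refine h1.trans ?_
    simp only [h2, h3, h4, Matrix.mulVec, dotProduct]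
    refine Finset.sum_congr rfl fun j _ => ?_
    rw [mul_comm]
    congr 1
    rw [Finset.sum_eq_single j (fun l _ hl => by simp [complexVec, hl]) (by simp)]
    simp [complexVec]
  have hx0 : ∀ T, (∀ t ∈ Icc 0 T, f t = 0) → ∀ t ∈ Icc 0 T, x t = 0 := by
    intro T h t ht
    ext i
    refine Finset.sum_eq_zero fun j _ =>
      intervalIntegral.integral_zero_ae (ae_of_all _ fun τ hτ => ?_)
    rw [uIoc_of_le ht.1] at hτ
    simp [h τ ⟨hτ.1.le, hτ.2.trans ht.2⟩]
  have hg := hf.add (hx.mulVec A)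
  refine ⟨ILC.primitive fun t => f t + A *ᵥ x t, hg.primitive.congr ?_,
    continuousOn_primitive_of_transformable hg.1, primitive_zero _, fun T h =>
      primitive_eq_zero fun t ht => by simp [h t ht, hx0 T h t ht]⟩
  filter_upwards [eventually_eq_resolvent_iff A, eventually_ne_zero] with s h1 h2
  rw [add_comm, ← (h1 _ _).1 rfl, smul_smul, inv_mul_cancel₀ h2, one_smul]

/-! ### Rank conditions -/

theorem isUnit_transpose_mul_self_of_rank_eq {m n : ℕ} {M : Matrix (Fin m) (Fin n) ℝ}
    (h : M.rank = n) : IsUnit (Mᵀ * M) := by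
  have h1 : (Mᵀ * M).rank = n := (Matrix.rank_transpose_mul_self M).trans h
  rw [← Matrix.mulVec_surjective_iff_isUnit]
  have h2 : LinearMap.range (Mᵀ * M).mulVecLin = ⊤ :=
    Submodule.eq_top_of_finrank_eq (by simpa [Matrix.rank] using h1)
  exact LinearMap.range_eq_top.1 h2

theorem exists_left_inverse_of_rank_eq {m n : ℕ} {M : Matrix (Fin m) (Fin n) ℝ}
    (h : M.rank = n) : ∃ L : Matrix (Fin n) (Fin m) ℝ, L * M = 1 := by
  refine ⟨(Mᵀ * M)⁻¹ * Mᵀ, ?_⟩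
  rw [Matrix.mul_assoc, Matrix.nonsing_inv_mul _
    ((Matrix.isUnit_iff_isUnit_det _).1 (isUnit_transpose_mul_self_of_rank_eq h))]

theorem exists_right_inverse_of_rank_eq {m n : ℕ} {M : Matrix (Fin m) (Fin n) ℝ}
    (h : M.rank = m) : ∃ R : Matrix (Fin n) (Fin m) ℝ, M * R = 1 := by
  obtain ⟨L, hL⟩ := exists_left_inverse_of_rank_eq (M := Mᵀ) ((Matrix.rank_transpose M).trans h)
  exact ⟨Lᵀ, by rw [← Matrix.transpose_transpose M, ← Matrix.transpose_mul, hL,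
    Matrix.transpose_one]⟩

theorem exists_mulVec_eq_zero_of_lt {m n : ℕ} (M : Matrix (Fin m) (Fin n) ℝ) (h : m < n) :
    ∃ k : Fin n → ℝ, k ≠ 0 ∧ M *ᵥ k = 0 := by
  obtain ⟨k, hk, h0⟩ := Submodule.exists_mem_ne_zero_of_ne_bot
    (LinearMap.ker_ne_bot_of_finrank_lt (f := M.mulVecLin) (by simpa using h))
  exact ⟨k, h0, by simpa using hk⟩

/-! ### The transfer functions -/

section TransferFunctions

variable {n p q : ℕ} (A : Matrix (Fin n) (Fin n) ℝ) (B : Matrix (Fin n) (Fin p) ℝ)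
  (C : Matrix (Fin q) (Fin n) ℝ)

theorem transferInput_mulVec (s : ℂ) (U : Fin p → ℂ) :
    transferInput A B C s *ᵥ U =
      complexify C *ᵥ (resolventMatrix A s *ᵥ (complexify B *ᵥ U)) := by
  simp only [transferInput, Matrix.mulVec_mulVec, Matrix.mul_assoc, complexify]

theorem transferDisturbance_mulVec (x₀ : Fin n → ℝ) (w : ℝ → Fin n → ℝ) (s : ℂ) :
    transferDisturbance A C s *ᵥ disturbance x₀ w s =
      complexify C *ᵥ (resolventMatrix A s *ᵥ (complexVec x₀ + laplace w s)) := by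
  simp only [transferDisturbance, disturbance, Matrix.fromCols_mulVec_sumElim,
    Matrix.mulVec_add, Matrix.mulVec_mulVec, complexify]
  rfl

/-- If `CB` has full column rank then `G₁ᵀ G₁` is invertible for large `re s`: up to a scalar
factor it tends to `(CB)ᵀ(CB)`. -/
theorem eventually_isUnit_transpose_mul_self (h : (C * B).rank = p) :
    ∀ᶠ s in rightHalfPlanes,
      IsUnit ((transferInput A B C s)ᵀ * transferInput A B C s).det := by
  let M : ℂ → Matrix (Fin q) (Fin p) ℂ := fun ε =>
    complexify C * (1 - ε • complexify A).adjugate * complexify B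
  have hM : Continuous fun ε => ((M ε)ᵀ * M ε).det := by fun_prop
  have h0 : ((M 0)ᵀ * M 0).det ≠ 0 := by
    have h1 : (M 0)ᵀ * M 0 = complexify ((C * B)ᵀ * (C * B)) := by
      simp only [M, zero_smul, sub_zero, Matrix.adjugate_one, Matrix.mul_one, ← complexify_mul]
      rw [complexify_mul (C * B)ᵀ]
      rfl
    have h2 : (complexify ((C * B)ᵀ * (C * B))).det = (((C * B)ᵀ * (C * B)).det : ℂ) :=
      (RingHom.map_det Complex.ofRealHom _).symm
    rw [h1, h2]
    exact_mod_cast ((Matrix.isUnit_iff_isUnit_det _).1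
      (isUnit_transpose_mul_self_of_rank_eq h)).ne_zero
  filter_upwards [tendsto_inv_rightHalfPlanes.eventually ((hM.tendsto 0).eventually_ne h0),
    eventually_ne_zero, eventually_det_one_sub_ne_zero (complexify A)] with s h1 h2 h3
  have h4 : resolventMatrix A s =
      (s⁻¹ * ((1 - s⁻¹ • complexify A).det)⁻¹) • (1 - s⁻¹ • complexify A).adjugate := by
    refine Matrix.inv_eq_right_inv ?_
    change (s • (1 : Matrix (Fin n) (Fin n) ℂ) - complexify A) * _ = 1
    rw [smul_one_sub_eq _ h2, Matrix.smul_mul, Matrix.mul_smul, Matrix.mul_adjugate, smul_smul,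
      smul_smul]
    rw [mul_inv_cancel_left₀ h2, inv_mul_cancel₀ h3, one_smul]
  have h5 : transferInput A B C s =
      (s⁻¹ * ((1 - s⁻¹ • complexify A).det)⁻¹) • M s⁻¹ := by
    simp only [transferInput, h4, M, Matrix.mul_smul, Matrix.smul_mul, complexify]
  rw [h5, Matrix.transpose_smul, Matrix.smul_mul, Matrix.mul_smul, smul_smul, Matrix.det_smul,
    isUnit_iff_ne_zero]
  exact mul_ne_zero (pow_ne_zero _ (mul_self_ne_zero.2
    (mul_ne_zero (inv_ne_zero h2) (inv_ne_zero h3)))) h1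

/-- The response to the initial state `x₀` and the disturbance `w`, without input. -/
theorem exists_free_response (x₀ : Fin n → ℝ) {w : ℝ → Fin n → ℝ} (hw : LaplaceTransformable w) :
    ∃ ξ : ℝ → Fin n → ℝ,
      IsLaplacePair ξ (fun s => resolventMatrix A s *ᵥ (complexVec x₀ + laplace w s)) ∧
      (∀ T, ContinuousOn ξ (Icc 0 T)) ∧ ξ 0 = x₀ := by
  -- `ξ - x₀` is the response from the zero state to `w + A x₀`.
  obtain ⟨x, hx, hxc, hx0, -⟩ :=
    (hw.isLaplacePair.add (isLaplacePair_const (A *ᵥ x₀))).exists_response A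
  refine ⟨fun t => x₀ + x t, ((isLaplacePair_const x₀).add hx).resolvent A ?_,
    fun T => continuousOn_const.add (hxc T), by simp [hx0]⟩
  filter_upwards [eventually_eq_resolvent_iff A, eventually_ne_zero] with s h1 h2
  have h3 := (h1 _ (laplace w s + s⁻¹ • complexVec (A *ᵥ x₀))).1 rfl
  generalize resolventMatrix A s *ᵥ _ = X at h3 ⊢
  rw [smul_add, h3, smul_smul, mul_inv_cancel₀ h2, one_smul, complexVec_mulVec,
    Matrix.mulVec_add, Matrix.mulVec_smul]
  abel

/-- The input `u = η - M C A x`, where `x' = A x + B u`: feeding `η` into the loop closed by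
`M C A`. -/
theorem exists_feedback_input {η : ℝ → Fin p → ℝ} {H : ℂ → Fin p → ℂ} (hη : IsLaplacePair η H)
    (M : Matrix (Fin p) (Fin q) ℝ) :
    ∃ (u : ℝ → Fin p → ℝ) (U : ℂ → Fin p → ℂ) (X : ℂ → Fin n → ℂ), IsLaplacePair u U ∧
      (∀ T, ContinuousOn η (Icc 0 T) → ContinuousOn u (Icc 0 T)) ∧ u 0 = η 0 ∧
      ∀ᶠ s in rightHalfPlanes, transferInput A B C s *ᵥ U s = complexify C *ᵥ X s ∧
        s • X s = complexify A *ᵥ X s + complexify B *ᵥ U s ∧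
        U s = H s - complexify (M * C * A) *ᵥ X s := by
  obtain ⟨x, hx, hxc, hx0, -⟩ := (hη.mulVec B).exists_response (A - B * (M * C * A))
  refine ⟨fun t => η t - (M * C * A) *ᵥ x t, _,
    fun s => resolventMatrix (A - B * (M * C * A)) s *ᵥ (complexify B *ᵥ H s),
    hη.sub (hx.mulVec (M * C * A)),
    fun T hT => hT.sub (continuousOn_mulVec _ (hxc T)), by simp [hx0], ?_⟩
  · filter_upwards [eventually_eq_resolvent_iff A,
      eventually_eq_resolvent_iff (A - B * (M * C * A))] with s h1 h2
    have h3 := (h2 _ (complexify B *ᵥ H s)).1 rfl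
    have h4 : s • (resolventMatrix (A - B * (M * C * A)) s *ᵥ (complexify B *ᵥ H s)) =
        complexify A *ᵥ (resolventMatrix (A - B * (M * C * A)) s *ᵥ (complexify B *ᵥ H s)) +
        complexify B *ᵥ (H s - complexify (M * C * A) *ᵥ
          (resolventMatrix (A - B * (M * C * A)) s *ᵥ (complexify B *ᵥ H s))) := by
      rw [h3, complexify_sub, Matrix.sub_mulVec, complexify_mul B, ← Matrix.mulVec_mulVec,
        Matrix.mulVec_sub]
      abel
    refine ⟨?_, h4, rfl⟩
    rw [transferInput_mulVec, ← (h1 _ _).2 h4]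

/-- If `CB` has a right inverse `R`, every signal with transform `s⁻¹ CB H(s)` is an output of the
system started at rest. -/
theorem exists_input_of_right_inverse {η : ℝ → Fin p → ℝ} {H : ℂ → Fin p → ℂ}
    (hη : IsLaplacePair η H) {R : Matrix (Fin p) (Fin q) ℝ} (hR : C * B * R = 1) :
    ∃ (u : ℝ → Fin p → ℝ) (U : ℂ → Fin p → ℂ), IsLaplacePair u U ∧
      (∀ T, ContinuousOn η (Icc 0 T) → ContinuousOn u (Icc 0 T)) ∧ u 0 = η 0 ∧
      ∀ᶠ s in rightHalfPlanes,
        transferInput A B C s *ᵥ U s = s⁻¹ • complexify (C * B) *ᵥ H s := by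
  obtain ⟨u, U, X, hu, huc, hu0, h⟩ := exists_feedback_input A B C hη R
  refine ⟨u, U, hu, huc, hu0, ?_⟩
  filter_upwards [h, eventually_ne_zero] with s ⟨h1, h2, h3⟩ hs
  have hR' : complexify C * complexify B * complexify R = 1 := by
    rw [← complexify_mul, ← complexify_mul, hR, complexify_one]
  rw [h1, eq_inv_smul_iff₀ hs, ← Matrix.mulVec_smul, h2, h3]
  simp only [Matrix.mulVec_add, Matrix.mulVec_sub, Matrix.mulVec_mulVec, complexify_mul,
    ← Matrix.mul_assoc, hR', Matrix.one_mul]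
  abel

/-- With a left inverse `L` of `CB`, the state of a system at rest is determined by its output `V`:
it has the transform `X = (sI - Â)⁻¹ s B L V` for `Â = A - B L C A`. -/
theorem state_eq_of_left_inverse {L : Matrix (Fin p) (Fin q) ℝ} (hL : L * (C * B) = 1) {s : ℂ}
    {X : Fin n → ℂ} {U : Fin p → ℂ} (h : s • X = complexify A *ᵥ X + complexify B *ᵥ U) :
    U = s • complexify (L * C) *ᵥ X - complexify (L * C * A) *ᵥ X ∧
    s • X = complexify (A - B * (L * C * A)) *ᵥ X +
      s • (complexify (B * L) *ᵥ (complexify C *ᵥ X)) := by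
  have hL' : complexify L * complexify C * complexify B = 1 := by
    rw [← complexify_mul, ← complexify_mul, Matrix.mul_assoc, hL, complexify_one]
  have h1 : U = s • complexify (L * C) *ᵥ X - complexify (L * C * A) *ᵥ X := by
    rw [← Matrix.mulVec_smul, h]
    simp only [Matrix.mulVec_add, Matrix.mulVec_mulVec, complexify_mul, hL', Matrix.one_mulVec]
    abel
  refine ⟨h1, ?_⟩
  conv_lhs => rw [h, h1]
  simp only [Matrix.mulVec_sub, Matrix.mulVec_smul, Matrix.mulVec_mulVec, complexify_mul,
    complexify_sub, Matrix.sub_mulVec, Matrix.mul_assoc]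
  abel

/-- Absorbing the differentiation: `s (sI - A)⁻¹ F = F + A (sI - A)⁻¹ F`. -/
theorem eventually_eq_add_mulVec_resolvent : ∀ᶠ s in rightHalfPlanes, ∀ X F : Fin n → ℂ,
    s • X = complexify A *ᵥ X + s • F →
      X = F + complexify A *ᵥ (resolventMatrix A s *ᵥ F) := by
  filter_upwards [eventually_eq_resolvent_iff A] with s h X F hX
  rw [(h _ _).2 hX]
  refine ((h _ _).2 ?_).symm
  rw [smul_add, ← Matrix.mulVec_smul (complexify A), (h _ F).1 rfl, Matrix.mulVec_add,
    Matrix.mulVec_add]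
  abel

end TransferFunctions

/-! ### Generation of trajectories -/

section Generation

variable {n p q : ℕ} {A : Matrix (Fin n) (Fin n) ℝ} {B : Matrix (Fin n) (Fin p) ℝ}
  {C : Matrix (Fin q) (Fin n) ℝ} {x₀ : Fin n → ℝ} {T : ℝ} {w : ℝ → Fin n → ℝ}
  {y : ℝ → Fin q → ℝ}

/-- The output transform `G₂ D` in the absence of an input. -/
noncomputable def freeOutput (A : Matrix (Fin n) (Fin n) ℝ) (C : Matrix (Fin q) (Fin n) ℝ)
    (x₀ : Fin n → ℝ) (w : ℝ → Fin n → ℝ) (s : ℂ) : Fin q → ℂ :=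
  transferDisturbance A C s *ᵥ disturbance x₀ w s

theorem ssGenerates_of_isLaplacePair {u : ℝ → Fin p → ℝ} {U : ℂ → Fin p → ℂ}
    {y' : ℝ → Fin q → ℝ} {Y' : ℂ → Fin q → ℂ} (hu : IsLaplacePair u U) (hy : IsLaplacePair y' Y')
    (hyy : EqOn y' y (Icc 0 T)) (h : ∀ᶠ s in rightHalfPlanes,
      transferInput A B C s *ᵥ U s = Y' s - freeOutput A C x₀ w s) :
    SSGenerates A B C x₀ w T u y := by
  refine ⟨u, y', ⟨hu.1, fun _ _ => rfl⟩, ⟨hy.1, hyy⟩, freqEq_iff.2 ?_⟩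
  filter_upwards [hu.2, hy.2, h] with s h1 h2 h3
  rw [h1, h2]
  exact h3

theorem exists_free_output (hw : LaplaceTransformable w) : ∃ ξ : ℝ → Fin n → ℝ,
    (∀ T, ContinuousOn ξ (Icc 0 T)) ∧ ξ 0 = x₀ ∧ ∃ Ξ : ℂ → Fin n → ℂ, IsLaplacePair ξ Ξ ∧
      (∀ s, freeOutput A C x₀ w s = complexify C *ᵥ Ξ s) ∧
      ∀ᶠ s in rightHalfPlanes,
        s • Ξ s = complexify A *ᵥ Ξ s + (complexVec x₀ + laplace w s) := by
  obtain ⟨ξ, h1, h2, h3⟩ := exists_free_response A x₀ hw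
  refine ⟨ξ, h2, h3, _, h1, transferDisturbance_mulVec A C x₀ w, ?_⟩
  filter_upwards [eventually_eq_resolvent_iff A] with s h
  exact (h _ _).1 rfl

/-- A generated trajectory starts at `C x₀`, since outputs of the system are continuous. -/
theorem SSGenerates.initial_eq (hT : 0 < T) (hw : LaplaceTransformable w)
    (hyc : ContinuousOn y (Icc 0 T)) {u : ℝ → Fin p → ℝ} (h : SSGenerates A B C x₀ w T u y) :
    y 0 = C *ᵥ x₀ := by
  obtain ⟨u', y', ⟨hu', -⟩, ⟨hy', hyy⟩, hfreq⟩ := h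
  obtain ⟨ξ, hξc, hξ0, Ξ, hξ, hfree, -⟩ := exists_free_output (A := A) (C := C) (x₀ := x₀) hw
  obtain ⟨x, hx, hxc, hx0, -⟩ := (hu'.isLaplacePair.mulVec B).exists_response A
  have h0 : (0 : ℝ) ∈ Icc 0 T := left_mem_Icc.2 hT.le
  have h2 : EqOn y' (fun t => C *ᵥ ξ t + C *ᵥ x t) (Icc 0 T) := by
    refine hy'.isLaplacePair.eqOn hT ?_ (hyc.congr hyy)
      ((continuousOn_mulVec C (hξc T)).add (continuousOn_mulVec C (hxc T)))
    refine ((hξ.mulVec C).add (hx.mulVec C)).congr ?_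
    filter_upwards [freqEq_iff.1 hfreq] with s hs
    rw [← transferInput_mulVec, hs, ← hfree, freeOutput]
    abel
  rw [← hyy h0, h2 h0]
  simp [hξ0, hx0]

/-- A `C¹` trajectory `y` with `y(0) = C x₀` has an extension whose deviation from the free output
is the primitive of a signal `z` continuous on `[0, T]`. -/
theorem exists_extension_eq_primitive (hT : 0 < T) (hw : LaplaceTransformable w)
    (hwc : ContinuousOn w (Icc 0 T)) (hy : ContDiffOn ℝ 1 y (Icc 0 T)) (hy0 : y 0 = C *ᵥ x₀) :
    ∃ (y' z : ℝ → Fin q → ℝ) (Y' Z : ℂ → Fin q → ℂ), IsLaplacePair y' Y' ∧ IsLaplacePair z Z ∧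
      EqOn y' y (Icc 0 T) ∧ ContinuousOn z (Icc 0 T) ∧
      ∀ᶠ s in rightHalfPlanes, Y' s - freeOutput A C x₀ w s = s⁻¹ • Z s := by
  obtain ⟨ξ, hξc, hξ0, Ξ, hξ, hfree, hΞ⟩ := exists_free_output (A := A) (C := C) (x₀ := x₀) hw
  let d : ℝ → Fin q → ℝ := indicator (Icc 0 T) (derivWithin y (Icc 0 T))
  have hdd : EqOn d (derivWithin y (Icc 0 T)) (Icc 0 T) := fun t ht => indicator_of_mem ht _
  have hdc : ContinuousOn d (Icc 0 T) :=
    (hy.continuousOn_derivWithin (uniqueDiffOn_Icc hT) le_rfl).congr hdd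
  have hdT : LaplaceTransformable d := by
    refine laplaceTransformable_iff.2 fun i => transformable_of_eqOn_zero
      ((continuousOn_pi.1 hdc i).integrableOn_compact isCompact_Icc) fun t ht => ?_
    simp [d, indicator_of_notMem (fun h : t ∈ Icc 0 T => ht.not_ge h.2)]
  have hd := hdT.isLaplacePair
  -- The primitive of `y'`, cut off after `T`, extends `y`; subtracting the derivative of `C ξ` from
  -- `y'` gives `z`.
  refine ⟨fun t => y 0 + primitive d t, fun t => d t - C *ᵥ (w t + A *ᵥ ξ t), _, _,
    (isLaplacePair_const _).add hd.primitive,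
    hd.sub ((hw.isLaplacePair.add (hξ.mulVec A)).mulVec C), ?_, ?_, ?_⟩
  · intro t ht
    ext i
    have hsub : Icc 0 t ⊆ Icc 0 T := Icc_subset_Icc_right ht.2
    have h1 := intervalIntegral.integral_eq_sub_of_hasDeriv_right_of_le
      (f := fun t => y t i) (f' := fun t => d t i) ht.1
      ((continuousOn_pi.1 hy.continuousOn i).mono hsub) (fun x hx => ?_)
      ((continuousOn_pi.1 (hdc.mono hsub) i).intervalIntegrable_of_Icc ht.1)
    · simp [primitive, h1]
    · have hx' : x ∈ Icc 0 T := hsub (Ioo_subset_Icc_self hx)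
      rw [hdd hx']
      have h2 := ((hy.differentiableOn one_ne_zero) x hx').hasDerivWithinAt
      refine (hasDerivWithinAt_pi.1 h2 i).mono_of_mem_nhdsWithin ?_
      exact mem_nhdsWithin_of_mem_nhds (Icc_mem_nhds hx.1 (hx.2.trans_le ht.2))
  · exact hdc.sub (continuousOn_mulVec C (hwc.add (continuousOn_mulVec A (hξc T))))
  · filter_upwards [hΞ, eventually_ne_zero] with s h1 h2
    have h3 : laplace w s + complexify A *ᵥ Ξ s = s • Ξ s - complexVec x₀ := by
      rw [h1]
      abel
    rw [hfree, h3, hy0, complexVec_mulVec, Matrix.mulVec_sub, Matrix.mulVec_smul, smul_sub,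
      smul_sub, smul_smul s⁻¹ s, inv_mul_cancel₀ h2, one_smul]
    abel

/-- If `CB` has a left inverse, two inputs generating the same trajectory agree almost
everywhere. -/
theorem SSGenerates.ae_eq (hT : 0 < T) {L : Matrix (Fin p) (Fin q) ℝ} (hL : L * (C * B) = 1)
    {u v : ℝ → Fin p → ℝ} (hu : SSGenerates A B C x₀ w T u y)
    (hv : SSGenerates A B C x₀ w T v y) : v =ᵐ[volume.restrict (Icc 0 T)] u := by
  obtain ⟨u', ya, ⟨hu', huu⟩, ⟨hya, hyya⟩, hfu⟩ := hu
  obtain ⟨v', yb, ⟨hv', hvv⟩, ⟨hyb, hyyb⟩, hfv⟩ := hv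
  have hδ := hv'.isLaplacePair.sub hu'.isLaplacePair
  have he := hyb.isLaplacePair.sub hya.isLaplacePair
  have he0 : ∀ t ∈ Icc 0 T, yb t - ya t = 0 := fun t ht => by rw [hyya ht, hyyb ht, sub_self]
  obtain ⟨x, hx, -⟩ := (hδ.mulVec B).exists_response A
  obtain ⟨g, hg, -, -, hg0⟩ :=
    (he.mulVec (B * L)).exists_response (A - B * (L * C * A))
  have hE : ∀ᶠ s in rightHalfPlanes, laplace yb s - laplace ya s =
      complexify C *ᵥ (resolventMatrix A s *ᵥ (complexify B *ᵥ (laplace v' s - laplace u' s))) := by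
    filter_upwards [freqEq_iff.1 hfu, freqEq_iff.1 hfv] with s h1 h2
    rw [← transferInput_mulVec, Matrix.mulVec_sub, h1, h2]
    abel
  -- The state difference vanishes on `[0, T]`: it depends causally on the output difference.
  have hx0 : ∀ᵐ t, t ∈ Icc 0 T → x t = 0 := by
    have h1 := (he.mulVec (B * L)).add (hg.mulVec (A - B * (L * C * A)))
    have h2 := hx.ae_eq (h1.congr ?_)
    · filter_upwards [h2] with t ht htm
      have hg0' := hg0 T (fun t ht => by rw [he0 t ht, Matrix.mulVec_zero]) t htm
      rw [ht htm.1, he0 t htm, hg0', Matrix.mulVec_zero, Matrix.mulVec_zero, add_zero]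
    · filter_upwards [hE, eventually_eq_resolvent_iff A,
        eventually_eq_add_mulVec_resolvent (A - B * (L * C * A))] with s h3 h4 h5
      rw [h3]
      exact (h5 _ _ (state_eq_of_left_inverse A B C hL ((h4 _ _).1 rfl)).2).symm
  -- The transformed identity `L e = ∫ (δ + L C A x)` recovers the input difference `δ`.
  have hp := hδ.add (hx.mulVec (L * C * A))
  have hprim : EqOn (primitive fun t => v' t - u' t + (L * C * A) *ᵥ x t)
      (fun t => L *ᵥ (yb t - ya t)) (Icc 0 T) := by
    refine hp.primitive.eqOn hT ((he.mulVec L).congr ?_)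
      (continuousOn_primitive_of_transformable hp.1 T)
      (continuousOn_const.congr fun t ht => by rw [he0 t ht])
    filter_upwards [hE, eventually_eq_resolvent_iff A, eventually_ne_zero] with s h3 h4 hs
    have h5 := (state_eq_of_left_inverse A B C hL
      ((h4 _ (complexify B *ᵥ (laplace v' s - laplace u' s))).1 rfl)).1
    generalize resolventMatrix A s *ᵥ _ = X at h3 h5 ⊢
    rw [h3, h5, sub_add_cancel, smul_smul, inv_mul_cancel₀ hs, one_smul, Matrix.mulVec_mulVec,
      complexify_mul]
  have h6 := ae_eq_zero_of_primitive_eq_zero hT hp.1 fun t ht =>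
    (hprim ht).trans (by simp only [he0 t ht, Matrix.mulVec_zero])
  filter_upwards [h6, ae_restrict_of_ae hx0, ae_restrict_mem measurableSet_Icc] with t h7 h8 ht
  rw [h8 ht, Matrix.mulVec_zero, add_zero, sub_eq_zero] at h7
  rw [← hvv ht, ← huu ht, h7]

/-- If `CB` has a left inverse, a trajectory with the right initial value that satisfies the
projection equation is generated by a continuous input. -/
theorem exists_continuousOn_ssGenerates_of_projection (hT : 0 < T)
    (hw : LaplaceTransformable w) (hwc : ContinuousOn w (Icc 0 T))
    (hy : ContDiffOn ℝ 1 y (Icc 0 T)) (hy0 : y 0 = C *ᵥ x₀)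
    {L : Matrix (Fin p) (Fin q) ℝ} (hL : L * (C * B) = 1) (h : SSProjectionEq A B C x₀ w T y) :
    ∃ u : ℝ → Fin p → ℝ, ContinuousOn u (Icc 0 T) ∧ SSGenerates A B C x₀ w T u y := by
  obtain ⟨y₁, ⟨hy₁, hyy₁⟩, hproj⟩ := h
  obtain ⟨y₂, z, Y₂, Z, hy₂, hz, hyy₂, hzc, hZ⟩ :=
    exists_extension_eq_primitive (A := A) hT hw hwc hy hy0
  obtain ⟨u, U, X, hu, huc, -, hU⟩ := exists_feedback_input A B C (hz.mulVec L) L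
  have he := hy₂.sub hy₁.isLaplacePair
  have he0 : ∀ t ∈ Icc 0 T, y₂ t - y₁ t = 0 := fun t ht => by rw [hyy₁ ht, hyy₂ ht, sub_self]
  obtain ⟨g, hg, -, -, hg0⟩ :=
    (he.mulVec (B * L)).exists_response (A - B * (L * C * A))
  have hg0' := hg0 T (fun t ht => by rw [he0 t ht, Matrix.mulVec_zero])
  -- Every correction to `y₂` vanishes on `[0, T]`.
  have hY := (hy₂.sub he).add (((he.mulVec (B * L)).add (hg.mulVec (A - B * (L * C * A)))).mulVec C)
  refine ⟨u, huc T (continuousOn_mulVec L hzc), ssGenerates_of_isLaplacePair hu hY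
    (fun t ht => ?_) ?_⟩
  · simp only [he0 t ht, hg0' t ht, Matrix.mulVec_zero, add_zero, sub_zero]
    exact hyy₂ ht
  · filter_upwards [hU, hZ, freqEq_iff.1 hproj, eventually_eq_resolvent_iff A,
      eventually_eq_add_mulVec_resolvent (A - B * (L * C * A)), eventually_ne_zero]
      with s ⟨h1, h2, h3⟩ hZs hP hA hcl hs
    -- The projection equation puts `V = Y₁ - G₂ D` into the range of `G₁`.
    obtain ⟨N, hN⟩ : ∃ N : Fin p → ℂ,
        transferInput A B C s *ᵥ N = laplace y₁ s - freeOutput A C x₀ w s := by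
      rw [Matrix.sub_mulVec, Matrix.one_mulVec, Matrix.mul_assoc, ← Matrix.mulVec_mulVec,
        sub_eq_zero] at hP
      exact ⟨_, hP.symm⟩
    rw [transferInput_mulVec] at hN
    have hX₁ := (hA _ (complexify B *ᵥ N)).1 rfl
    generalize resolventMatrix A s *ᵥ (complexify B *ᵥ N) = X₁ at hN hX₁
    have hX₁' := (state_eq_of_left_inverse A B C hL hX₁).2
    have hX : s • (X s - X₁) = complexify (A - B * (L * C * A)) *ᵥ (X s - X₁) +
        s • (complexify (B * L) *ᵥ (Y₂ s - laplace y₁ s)) := by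
      have hV : Y₂ s - laplace y₁ s = s⁻¹ • Z s - complexify C *ᵥ X₁ := by
        rw [hN, ← hZs]
        abel
      rw [smul_sub, hX₁', h2, h3, hV, Matrix.mulVec_sub (complexify (B * L)), Matrix.mulVec_smul,
        smul_sub, smul_smul, mul_inv_cancel₀ hs, one_smul, complexify_sub, complexify_mul B,
        complexify_mul B]
      simp only [Matrix.sub_mulVec, Matrix.mulVec_sub, Matrix.mulVec_mulVec]
      abel
    rw [h1, ← hcl _ _ hX, Matrix.mulVec_sub, hN]
    abel

/-- Generated trajectories satisfy the projection equation when `CB` has full column rank. -/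
theorem SSGenerates.ssProjectionEq (hrank : (C * B).rank = p) {u : ℝ → Fin p → ℝ}
    (h : SSGenerates A B C x₀ w T u y) : SSProjectionEq A B C x₀ w T y := by
  obtain ⟨u', y', -, hy', hfreq⟩ := h
  refine ⟨y', hy', freqEq_iff.2 ?_⟩
  filter_upwards [freqEq_iff.1 hfreq, eventually_isUnit_transpose_mul_self A B C hrank]
    with s h1 h2
  rw [← h1, Matrix.mulVec_mulVec, Matrix.sub_mul, Matrix.one_mul, Matrix.mul_assoc,
    Matrix.mul_assoc, Matrix.nonsing_inv_mul _ h2, Matrix.mul_one, sub_self, Matrix.zero_mulVec]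

/-- If `CB` has a right inverse, a `C¹` trajectory with the right initial value is generated by a
continuous input; any `k` in the kernel of `CB` is the difference at time `0` of two such inputs. -/
theorem exists_continuousOn_ssGenerates_of_right_inverse (hT : 0 < T)
    (hw : LaplaceTransformable w) (hwc : ContinuousOn w (Icc 0 T))
    (hy : ContDiffOn ℝ 1 y (Icc 0 T)) (hy0 : y 0 = C *ᵥ x₀)
    {R : Matrix (Fin p) (Fin q) ℝ} (hR : C * B * R = 1) {k : Fin p → ℝ}
    (hk : (C * B) *ᵥ k = 0) :
    ∃ u v : ℝ → Fin p → ℝ, ContinuousOn u (Icc 0 T) ∧ ContinuousOn v (Icc 0 T) ∧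
      SSGenerates A B C x₀ w T u y ∧ SSGenerates A B C x₀ w T v y ∧ v 0 - u 0 = k := by
  obtain ⟨y', z, Y', Z, hy', hz, hyy', hzc, hZ⟩ :=
    exists_extension_eq_primitive (A := A) hT hw hwc hy hy0
  have hη := hz.mulVec R
  obtain ⟨u, U, hu, huc, hu0, hU⟩ := exists_input_of_right_inverse A B C hη hR
  obtain ⟨v, V, hv, hvc, hv0, hV⟩ :=
    exists_input_of_right_inverse A B C (hη.add (isLaplacePair_const k)) hR
  have hRZ (s : ℂ) : complexify (C * B) *ᵥ (complexify R *ᵥ Z s) = Z s := by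
    rw [Matrix.mulVec_mulVec, ← complexify_mul, hR, complexify_one, Matrix.one_mulVec]
  have hc := continuousOn_mulVec R hzc
  refine ⟨u, v, huc T hc, hvc T (hc.add continuousOn_const),
    ssGenerates_of_isLaplacePair hu hy' hyy' ?_, ssGenerates_of_isLaplacePair hv hy' hyy' ?_,
    by simp [hu0, hv0]⟩
  · filter_upwards [hU, hZ] with s h1 h2
    rw [h1, h2, hRZ]
  · filter_upwards [hV, hZ] with s h1 h2
    rw [h1, h2, Matrix.mulVec_add, hRZ, Matrix.mulVec_smul, ← complexVec_mulVec, hk]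
    simp [show complexVec (0 : Fin q → ℝ) = 0 by ext; simp [complexVec]]

end Generation

end ILC

theorem corollary2 {n p q : ℕ} (A : Matrix (Fin n) (Fin n) ℝ) (B : Matrix (Fin n) (Fin p) ℝ)
    (C : Matrix (Fin q) (Fin n) ℝ) (x₀ : Fin n → ℝ) (T : ℝ) (hT : 0 < T)
    (w : ℝ → Fin n → ℝ) (hw : ILC.LaplaceTransformable w) (hwc : ContinuousOn w (Icc 0 T))
    (y : ℝ → Fin q → ℝ) (hy : ContDiffOn ℝ 1 y (Icc 0 T)) :
    (p ≤ q → (C * B).rank = p →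
      (ILC.SSTrackable A B C x₀ w T y ↔ y 0 = C *ᵥ x₀ ∧ ILC.SSProjectionEq A B C x₀ w T y) ∧
      (ILC.SSTrackable A B C x₀ w T y →
        ∃ u : ℝ → Fin p → ℝ, ContinuousOn u (Icc 0 T) ∧ ILC.SSGenerates A B C x₀ w T u y ∧
          ∀ v : ℝ → Fin p → ℝ, ILC.SSGenerates A B C x₀ w T v y →
            v =ᵐ[volume.restrict (Icc 0 T)] u)) ∧
    (q ≤ p → (C * B).rank = q →
      (ILC.SSTrackable A B C x₀ w T y ↔ y 0 = C *ᵥ x₀) ∧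
      (q < p → ILC.SSTrackable A B C x₀ w T y →
        ∃ u v : ℝ → Fin p → ℝ, ContinuousOn u (Icc 0 T) ∧ ContinuousOn v (Icc 0 T) ∧
          ILC.SSGenerates A B C x₀ w T u y ∧ ILC.SSGenerates A B C x₀ w T v y ∧
          ¬ v =ᵐ[volume.restrict (Icc 0 T)] u)) := by
  have h0 : ILC.SSTrackable A B C x₀ w T y → y 0 = C *ᵥ x₀ := fun ⟨u, hu⟩ =>
    ILC.SSGenerates.initial_eq hT hw hy.continuousOn hu
  refine ⟨fun _ hrank => ?_, fun _ hrank => ?_⟩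
  · obtain ⟨L, hL⟩ := ILC.exists_left_inverse_of_rank_eq hrank
    have hproj : ILC.SSTrackable A B C x₀ w T y → ILC.SSProjectionEq A B C x₀ w T y :=
      fun ⟨u, hu⟩ => ILC.SSGenerates.ssProjectionEq hrank hu
    have hex := ILC.exists_continuousOn_ssGenerates_of_projection (A := A) (B := B) (C := C)
      (x₀ := x₀) hT hw hwc hy
    refine ⟨⟨fun h => ⟨h0 h, hproj h⟩, fun h => ?_⟩, fun h => ?_⟩
    · obtain ⟨u, -, hu⟩ := hex h.1 hL h.2
      exact ⟨u, hu⟩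
    · obtain ⟨u, huc, hu⟩ := hex (h0 h) hL (hproj h)
      exact ⟨u, huc, hu, fun v hv => ILC.SSGenerates.ae_eq hT hL hu hv⟩
  · obtain ⟨R, hR⟩ := ILC.exists_right_inverse_of_rank_eq hrank
    have hex (hy0 : y 0 = C *ᵥ x₀) (k : Fin p → ℝ) (hk : (C * B) *ᵥ k = 0) :=
      ILC.exists_continuousOn_ssGenerates_of_right_inverse (A := A) hT hw hwc hy hy0 hR hk
    refine ⟨⟨h0, fun hy0 => ?_⟩, fun hlt h => ?_⟩
    · obtain ⟨u, -, -, -, hu, -⟩ := hex hy0 0 (Matrix.mulVec_zero _)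
      exact ⟨u, hu⟩
    · obtain ⟨k, hk, hk0⟩ := ILC.exists_mulVec_eq_zero_of_lt (C * B) hlt
      obtain ⟨u, v, huc, hvc, hu, hv, huv⟩ := hex (h0 h) k hk0
      refine ⟨u, v, huc, hvc, hu, hv, fun hae => hk ?_⟩
      rw [← huv, Measure.eqOn_Icc_of_ae_eq volume hT.ne hae hvc huc (left_mem_Icc.2 hT.le),
        sub_self]
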